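/- Let $f$ be a monic centered complex polynomial of degree $d\ge 2$ (centered: the coefficient of $z^{d-1}$ vanishes), and let $f^n$ denote its $n$-th iterate. Let $a\in\mathbb{C}\setminus\{0\}$, $b\in\mathbb{C}$ and let $\phi$ be the affine map with $\phi^{-1}(z)=az+b$. For a polynomial map $g$ write $K_g$ for its filled Julia set, the set of points with bounded forward orbit under $g$. Let $$\mathcal{C}(\phi^{-1}\circ f^n)=\{(a',b')\in\mathbb{C}^2 \mid a'\neq 0,\ K_{a'f^n+b'}\text{ is connected}\}$$ be the connectedness locus of the $n$-th two-parameter family, and for a sequence of sets $S_n$ let $\liminf_{n\to\infty} S_n$ be the set of limits of convergent sequences $(s_n)$ with $s_n\in S_n$ for all sufficiently large $n$. Let $c$ be a critical point of $f$ and let $k\ge 0$ be an integer such that $\phi^{-1}(f^k(c))\notin K_f$. Then there is $N$ such that $\phi^{-1}(f^k(c))\notin K_{\phi^{-1}\circ f^n}$ for all $n\ge N$. If moreover $k\ge 1$, then $(a,b)\notin\liminf_{n\to\infty}\mathcal{C}(\phi^{-1}\circ f^n)$. -/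

import Mathlib

open Polynomial Filter Topology

/-- The filled Julia set of a map `g : ℂ → ℂ`: the points with bounded forward orbit. -/
def filledJulia (g : ℂ → ℂ) : Set ℂ :=
  {z | Bornology.IsBounded (Set.range fun m : ℕ => g^[m] z)}

/-- The map `φ⁻¹ ∘ fⁿ`, where `φ⁻¹(z) = a z + b` and `fⁿ` is the `n`-th iterate of `f`. -/
def affineIterate (f : ℂ[X]) (a b : ℂ) (n : ℕ) : ℂ → ℂ :=
  fun z => a * (fun w => f.eval w)^[n] z + b

/-- The connectedness locus of the two-parameter family `φ⁻¹ ∘ fⁿ`, `φ⁻¹(z) = a z + b` with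
`a ≠ 0`: the parameters whose filled Julia set is connected. -/
def connectednessLocus (f : ℂ[X]) (n : ℕ) : Set (ℂ × ℂ) :=
  {p | p.1 ≠ 0 ∧ IsConnected (filledJulia (affineIterate f p.1 p.2 n))}

/-- The lower limit of a sequence of sets: all limits of sequences `u n` with `u n ∈ S n`
for all large `n`. -/
def setLiminf {X : Type*} [TopologicalSpace X] (S : ℕ → Set X) : Set X :=
  {x | ∃ u : ℕ → X, (∀ᶠ n in atTop, u n ∈ S n) ∧ Tendsto u atTop (𝓝 x)}

/-- A polynomial of degree `d` is centered if its coefficient of `z ^ (d - 1)` vanishes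
(used for `d ≥ 2` only). -/
def IsCentered (f : ℂ[X]) : Prop :=
  f.coeff (f.natDegree - 1) = 0

/-! Once n is large and (a', b') is close to (a, b), the map a' f^n + b' at least doubles norms
outside a disc that depends only on f. Hence a point escaping under f also escapes under these maps,
even if it moves slightly with the parameters (`eventually_notMem_filledJulia`). For 1 ≤ k ≤ n the
point a' f^k(c) + b' is a critical value of a' f^n + b', so what remains is that an escaping
critical value makes the filled Julia set disconnected (`not_isConnected_filledJulia`).

Suppose instead that K_G is connected, let p ∈ K_G and D = deg G. All roots of G - p lie in K_G, so
G - p = lead · H^D on a region {R < |P|} away from K_G, where P is an iterate of G, H is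
holomorphic, and H is injective near infinity (`exists_root_of_isPreconnected`). Then H is injective
with nonzero derivative throughout the region: a failure with |P| maximal would persist under
perturbation, against the maximum principle for P (`dslope_ne_zero_of_large`). Since H vanishes only
where G = p, the derivative G' = lead · D · H^(D-1) · H' has no zero in the region, yet the critical
point lies there. -/

/-! ### Divided differences and univalence -/

/-- Divided differences of a holomorphic function are jointly continuous. -/
lemma continuousOn_uncurry_dslope {H : ℂ → ℂ} {s : Set ℂ} (hs : IsOpen s)
    (hH : DifferentiableOn ℂ H s) :
    ContinuousOn (fun p : ℂ × ℂ => dslope H p.1 p.2) (s ×ˢ s) := by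
  rintro ⟨x, y⟩ ⟨hx, hy⟩
  simp only at hx hy
  apply ContinuousAt.continuousWithinAt
  have hat : ∀ z ∈ s, ContinuousAt H z := fun z hz =>
    (hH.differentiableAt (hs.mem_nhds hz)).continuousAt
  by_cases hxy : y = x
  · subst hxy
    have han : AnalyticAt ℂ H y := hH.analyticAt (hs.mem_nhds hy)
    have hstrict : HasStrictDerivAt H (deriv H y) y := han.hasStrictDerivAt
    have hderiv : ContinuousAt (deriv H) y := han.deriv.continuousAt
    rw [Metric.continuousAt_iff']
    intro ε hε
    simp only [dslope_same]
    -- Strict differentiability handles nearby pairs off the diagonal; continuity of the derivative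
    -- handles those on it.
    have h1 : ∀ᶠ p : ℂ × ℂ in 𝓝 (y, y),
        ‖H p.1 - H p.2 - (p.1 - p.2) * deriv H y‖ ≤ ε / 2 * ‖p.1 - p.2‖ := by
      have := hstrict.isLittleO.def (half_pos hε)
      simpa using this
    have h2 : ∀ᶠ p : ℂ × ℂ in 𝓝 (y, y), dist (deriv H p.1) (deriv H y) < ε :=
      (continuousAt_fst (p := (y, y))).eventually
        ((Metric.continuousAt_iff'.1 hderiv) ε hε)
    filter_upwards [h1, h2] with p hp1 hp2
    by_cases hp : p.2 = p.1
    · rw [hp, dslope_same]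
      exact hp2
    · rw [dslope_of_ne _ hp, slope_def_field, dist_eq_norm]
      have hne : p.1 - p.2 ≠ 0 := sub_ne_zero.2 (Ne.symm hp)
      have hne' : p.2 - p.1 ≠ 0 := sub_ne_zero.2 hp
      have heq : (H p.2 - H p.1) / (p.2 - p.1) - deriv H y =
          (H p.1 - H p.2 - (p.1 - p.2) * deriv H y) / (p.1 - p.2) := by
        field_simp
        ring
      rw [heq, norm_div, div_lt_iff₀ (norm_pos_iff.2 hne)]
      nlinarith [norm_pos_iff.2 hne]
  · have hev : (fun p : ℂ × ℂ => dslope H p.1 p.2) =ᶠ[𝓝 (x, y)]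
        fun p => (H p.2 - H p.1) / (p.2 - p.1) := by
      have : ∀ᶠ p : ℂ × ℂ in 𝓝 (x, y), p.2 ≠ p.1 :=
        (isOpen_ne_fun continuous_snd continuous_fst).mem_nhds hxy
      filter_upwards [this] with p hp
      rw [dslope_of_ne _ hp, slope_def_field]
    refine ContinuousAt.congr ?_ hev.symm
    refine ContinuousAt.div ?_ (by fun_prop) (sub_ne_zero.2 hxy)
    exact ((hat y hy).comp (f := fun p : ℂ × ℂ => p.2) (x := (x, y)) continuousAt_snd).sub
      ((hat x hx).comp (f := fun p : ℂ × ℂ => p.1) (x := (x, y)) continuousAt_fst)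

/-- Zeros of `dslope H w` persist under small perturbations of `w`. -/
lemma eventually_exists_dslope_eq_zero {H : ℂ → ℂ} {s : Set ℂ} (hs : IsOpen s)
    (hH : DifferentiableOn ℂ H s) {z₀ w₀ : ℂ} (hz₀ : z₀ ∈ s) (hw₀ : w₀ ∈ s)
    (h0 : dslope H w₀ z₀ = 0) (hconst : ¬ ∀ᶠ z in 𝓝 z₀, H z = H w₀) :
    ∀ᶠ w in 𝓝 w₀, ∃ z ∈ s, dslope H w z = 0 := by
  have hdiff : ∀ w ∈ s, DifferentiableOn ℂ (dslope H w) s := fun w hw =>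
    (Complex.differentiableOn_dslope (hs.mem_nhds hw)).2 hH
  have hne : ∀ᶠ z in 𝓝[≠] z₀, dslope H w₀ z ≠ 0 := by
    rcases ((hdiff w₀ hw₀).analyticAt
      (hs.mem_nhds hz₀)).eventually_eq_zero_or_eventually_ne_zero with h | h
    · refine absurd ?_ hconst
      filter_upwards [h] with z hz
      have := sub_smul_dslope H w₀ z
      rw [hz, smul_zero] at this
      exact (sub_eq_zero.1 this.symm)
    · exact h
  rw [eventually_nhdsWithin_iff] at hne
  obtain ⟨r, hr, hball⟩ := Metric.nhds_basis_closedBall.mem_iff.1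
    (Filter.inter_mem hne (hs.mem_nhds hz₀))
  have hsub : Metric.closedBall z₀ r ⊆ s := fun z hz => (hball hz).2
  have hjoint := continuousOn_uncurry_dslope hs hH
  have hat : ∀ w ∈ s, ∀ z ∈ s, ContinuousAt (fun p : ℂ × ℂ => dslope H p.1 p.2) (w, z) :=
    fun w hw z hz => hjoint.continuousAt ((hs.prod hs).mem_nhds ⟨hw, hz⟩)
  have hcompact : IsCompact (Metric.sphere z₀ r) := isCompact_sphere z₀ r
  have hnonempty : (Metric.sphere z₀ r).Nonempty := NormedSpace.sphere_nonempty.2 hr.le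
  have hcont : ContinuousOn (fun z => ‖dslope H w₀ z‖) (Metric.sphere z₀ r) :=
    ((hdiff w₀ hw₀).continuousOn.mono
      (Metric.sphere_subset_closedBall.trans hsub)).norm
  obtain ⟨x, hx, hmin⟩ := hcompact.exists_isMinOn hnonempty hcont
  set δ := ‖dslope H w₀ x‖ with hδ
  have hδpos : 0 < δ := by
    refine norm_pos_iff.2 ((hball (Metric.sphere_subset_closedBall hx)).1 ?_)
    rintro rfl
    simp only [Metric.mem_sphere, dist_self] at hx
    exact hr.ne hx
  have hcenter : ContinuousAt (fun w => dslope H w z₀) w₀ :=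
    (hat w₀ hw₀ z₀ hz₀).comp (f := fun w => (w, z₀)) (by fun_prop)
  -- The quantitative open mapping theorem turns a variation of δ / 2 on the sphere into a covered
  -- disc of radius δ / 4, which must contain 0.
  have hev1 : ∀ᶠ w in 𝓝 w₀, ‖dslope H w z₀‖ < δ / 4 := by
    have := hcenter.norm
    refine this.eventually (gt_mem_nhds ?_) 
    simp only [h0, norm_zero]
    positivity
  have hev2 : ∀ᶠ w in 𝓝 w₀, ∀ z ∈ Metric.sphere z₀ r, δ / 2 < ‖dslope H w z - dslope H w z₀‖ := by
    refine hcompact.eventually_forall_of_forall_eventually ?_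
    intro z hz
    have hz' := hsub (Metric.sphere_subset_closedBall hz)
    have hc : ContinuousAt (fun p : ℂ × ℂ => ‖dslope H p.1 p.2 - dslope H p.1 z₀‖) (w₀, z) :=
      ((hat w₀ hw₀ z hz').sub (hcenter.comp (f := fun p : ℂ × ℂ => p.1) (x := (w₀, z))
        continuousAt_fst)).norm
    refine hc.eventually (lt_mem_nhds ?_)
    simp only [h0, sub_zero]
    have := isMinOn_iff.1 hmin z hz
    linarith
  filter_upwards [hev1, hev2, hs.mem_nhds hw₀] with w hw1 hw2 hws
  have hd : DiffContOnCl ℂ (dslope H w) (Metric.ball z₀ r) := by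
    refine DifferentiableOn.diffContOnCl ?_
    rw [closure_ball _ hr.ne']
    exact (hdiff w hws).mono hsub
  have hfreq : ∃ᶠ z in 𝓝 z₀, dslope H w z ≠ dslope H w z₀ := by
    by_contra hcon
    rw [not_frequently] at hcon
    simp only [not_not] at hcon
    have han : AnalyticOnNhd ℂ (dslope H w) (Metric.closedBall z₀ r) := fun z hz =>
      (hdiff w hws).analyticAt (hs.mem_nhds (hsub hz))
    have := han.eqOn_of_preconnected_of_eventuallyEq
      (analyticOnNhd_const (v := dslope H w z₀)) (convex_closedBall z₀ r).isPreconnected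
      (Metric.mem_closedBall_self hr.le) hcon
    have h3 := this (Metric.sphere_subset_closedBall hx)
    have h4 := hw2 x hx
    simp only at h3
    rw [h3] at h4
    simp at h4
    linarith
  have := hd.ball_subset_image_closedBall hr (ε := δ / 2) (fun z hz => (hw2 z hz).le) hfreq
  have hmem : (0 : ℂ) ∈ Metric.ball (dslope H w z₀) (δ / 2 / 2) := by
    rw [Metric.mem_ball, dist_eq_norm, zero_sub, norm_neg]
    linarith
  obtain ⟨z, hz, hz0⟩ := this hmem
  exact ⟨z, hsub hz, hz0⟩

lemma Polynomial.not_eventually_eval_eq {P : ℂ[X]} (hP : 0 < P.degree) (z₀ v : ℂ) :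
    ¬ ∀ᶠ z in 𝓝 z₀, P.eval z = v := by
  intro h
  have hinf : Set.Infinite {z | P.eval z = v} := infinite_of_mem_nhds z₀ h
  have : P = C v := by
    refine Polynomial.eq_of_infinite_eval_eq _ _ (hinf.mono ?_)
    intro z hz
    simpa using hz
  rw [this] at hP
  exact absurd hP (not_lt.2 degree_C_le)

lemma Polynomial.exists_norm_le_of_norm_eval_le {P : ℂ[X]} (hP : 0 < P.degree) (B : ℝ) :
    ∃ M : ℝ, ∀ z : ℂ, ‖P.eval z‖ ≤ B → ‖z‖ ≤ M := by
  have h : Tendsto (fun z : ℂ => ‖P.eval z‖) (Bornology.cobounded ℂ) atTop :=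
    P.tendsto_norm_atTop hP tendsto_norm_cobounded_atTop
  obtain ⟨M, -, hM⟩ := (Filter.HasBasis.cobounded_of_norm
    (atTop_basis (α := ℝ))).eventually_iff.1 (h.eventually_gt_atTop B)
  refine ⟨M, fun z hz => ?_⟩
  by_contra hcon
  exact absurd (hM (x := z) (le_of_lt (not_le.1 hcon))) (not_lt.2 hz)

/-- A holomorphic function on `{R < ‖P‖}` whose fibres lie in fibres of `P` and which is
univalent near infinity is univalent. -/
lemma dslope_ne_zero_of_large {P : ℂ[X]} (hP : 0 < P.degree) {R : ℝ} {H : ℂ → ℂ}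
    (hH : DifferentiableOn ℂ H {z | R < ‖P.eval z‖})
    (hHP : ∀ z w, R < ‖P.eval z‖ → R < ‖P.eval w‖ → H z = H w → P.eval z = P.eval w)
    (hlarge : ∃ M : ℝ, ∀ w, R < ‖P.eval w‖ → M < ‖w‖ → ∀ z, R < ‖P.eval z‖ →
      dslope H w z ≠ 0) {z w : ℂ} (hz : R < ‖P.eval z‖) (hw : R < ‖P.eval w‖) :
    dslope H w z ≠ 0 := by
  intro h0
  obtain ⟨M, hM⟩ := hlarge
  have hs : IsOpen {z : ℂ | R < ‖P.eval z‖} :=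
    isOpen_lt continuous_const P.continuous.norm
  have hHeq : ∀ w z, dslope H w z = 0 → H z = H w := by
    intro w z h
    have := sub_smul_dslope H w z
    rw [h, smul_zero] at this
    exact sub_eq_zero.1 this.symm
  set r := ‖P.eval w‖
  -- Pairs where injectivity fails, with a zero derivative on the diagonal. Both points have the
  -- same value of P, so bounding one bounds the other and T is compact.
  let T : Set (ℂ × ℂ) :=
    {p | (r ≤ ‖P.eval p.1‖ ∧ r ≤ ‖P.eval p.2‖) ∧ dslope H p.1 p.2 = 0}
  have hmem : (w, z) ∈ T := by
    refine ⟨⟨le_refl _, ?_⟩, h0⟩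
    simp only [hHP z w hz hw (hHeq w z h0)]
    exact le_refl _
  have hclosed : IsClosed T := by
    have hA : IsClosed {p : ℂ × ℂ | r ≤ ‖P.eval p.1‖ ∧ r ≤ ‖P.eval p.2‖} :=
      (isClosed_le continuous_const (P.continuous.comp continuous_fst).norm).inter
        (isClosed_le continuous_const (P.continuous.comp continuous_snd).norm)
    have hc := (continuousOn_uncurry_dslope hs hH).mono
      (t := {p : ℂ × ℂ | r ≤ ‖P.eval p.1‖ ∧ r ≤ ‖P.eval p.2‖})
      (fun p hp => ⟨lt_of_lt_of_le hw hp.1, lt_of_lt_of_le hw hp.2⟩)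
    exact hc.preimage_isClosed_of_isClosed hA (isClosed_singleton (x := (0 : ℂ)))
  have hbd1 : ∀ p ∈ T, ‖p.1‖ ≤ M := by
    intro p hp
    by_contra hcon
    exact hM p.1 (lt_of_lt_of_le hw hp.1.1) (not_le.1 hcon) p.2 (lt_of_lt_of_le hw hp.1.2) hp.2
  obtain ⟨B, hB⟩ := (isCompact_closedBall (0 : ℂ) M).exists_bound_of_continuousOn
    P.continuous.continuousOn
  obtain ⟨M', hM'⟩ := P.exists_norm_le_of_norm_eval_le hP B
  have hbd2 : ∀ p ∈ T, ‖p.2‖ ≤ M' := by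
    intro p hp
    apply hM'
    rw [hHP p.2 p.1 (lt_of_lt_of_le hw hp.1.2) (lt_of_lt_of_le hw hp.1.1) (hHeq _ _ hp.2)]
    exact hB _ (by simpa using hbd1 p hp)
  have hcompact : IsCompact T := by
    refine ((isCompact_closedBall (0 : ℂ) M).prod
      (isCompact_closedBall (0 : ℂ) M')).of_isClosed_subset hclosed ?_
    intro p hp
    exact ⟨by simpa using hbd1 p hp, by simpa using hbd2 p hp⟩
  obtain ⟨⟨w₀, z₀⟩, hT, hmax⟩ := hcompact.exists_isMaxOn ⟨_, hmem⟩
    (f := fun p : ℂ × ℂ => ‖P.eval p.1‖) (P.continuous.comp continuous_fst).norm.continuousOn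
  have hw₀ : R < ‖P.eval w₀‖ := lt_of_lt_of_le hw hT.1.1
  have hz₀ : R < ‖P.eval z₀‖ := lt_of_lt_of_le hw hT.1.2
  have hnc : ¬ ∀ᶠ z in 𝓝 z₀, H z = H w₀ := by
    intro hcon
    refine P.not_eventually_eval_eq hP z₀ (P.eval w₀) ?_
    filter_upwards [hcon, hs.mem_nhds hz₀] with z hz1 hz2
    exact hHP z w₀ hz2 hw₀ hz1
  have hopen := eventually_exists_dslope_eq_zero hs hH (z₀ := z₀) (w₀ := w₀) hz₀ hw₀ hT.2 hnc
  have hlocmax : IsLocalMax (norm ∘ fun z => P.eval z) w₀ := by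
    filter_upwards [hopen, hs.mem_nhds hw₀] with w' hw' hw's
    obtain ⟨z', hz's, hz'⟩ := hw'
    simp only [Function.comp]
    by_contra hcon
    rw [not_le] at hcon
    have hr' : r ≤ ‖P.eval w'‖ := hT.1.1.trans hcon.le
    have : (w', z') ∈ T := by
      refine ⟨⟨hr', ?_⟩, hz'⟩
      simp only [hHP z' w' hz's hw's (hHeq _ _ hz')]
      exact hr'
    have h5 := isMaxOn_iff.1 hmax _ this
    simp only at h5
    linarith
  exact P.not_eventually_eval_eq hP w₀ (P.eval w₀)
    (Complex.eventually_eq_of_isLocalMax_norm (Eventually.of_forall fun z => P.differentiableAt)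
      hlocmax)

/-! ### Logarithms and roots outside a connected set -/

/-- A function holomorphic on `s` and at infinity. -/
def HolomorphicAtInfinityOn (L : ℂ → ℂ) (s : Set ℂ) : Prop :=
  DifferentiableOn ℂ L s ∧
    ∃ l : ℂ → ℂ, AnalyticAt ℂ l 0 ∧ ∀ᶠ z in Bornology.cobounded ℂ, L z = l z⁻¹

namespace HolomorphicAtInfinityOn

variable {L L' : ℂ → ℂ} {s : Set ℂ}

lemma zero : HolomorphicAtInfinityOn (fun _ => 0) s :=
  ⟨differentiableOn_const _, fun _ => 0, analyticAt_const, Eventually.of_forall fun _ => rfl⟩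

lemma add (h : HolomorphicAtInfinityOn L s) (h' : HolomorphicAtInfinityOn L' s) :
    HolomorphicAtInfinityOn (fun z => L z + L' z) s := by
  obtain ⟨hL, l, hl, he⟩ := h
  obtain ⟨hL', l', hl', he'⟩ := h'
  refine ⟨hL.add hL', fun u => l u + l' u, hl.add hl', ?_⟩
  filter_upwards [he, he'] with z h1 h2
  rw [h1, h2]

lemma const_mul (h : HolomorphicAtInfinityOn L s) (a : ℂ) :
    HolomorphicAtInfinityOn (fun z => a * L z) s := by
  obtain ⟨hL, l, hl, he⟩ := h
  refine ⟨hL.const_mul a, fun u => a * l u, analyticAt_const.mul hl, ?_⟩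
  filter_upwards [he] with z h1
  rw [h1]

end HolomorphicAtInfinityOn

/-- If `K` is connected and at positive distance from `s`, then `(z - x) / (z - y)` has a
holomorphic logarithm on `s` for all `x, y ∈ K`. -/
lemma exists_log_div_of_isPreconnected {K s : Set ℂ} (hK : IsPreconnected K) {ε : ℝ} (hε : 0 < ε)
    (hdist : ∀ x ∈ K, ∀ z ∈ s, ε ≤ ‖z - x‖) {x y : ℂ} (hx : x ∈ K) (hy : y ∈ K) :
    ∃ L, HolomorphicAtInfinityOn L s ∧ ∀ z ∈ s, z - x = (z - y) * Complex.exp (L z) := by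
  -- The relation is transitive and symmetric, so connectedness reduces it to nearby points, where
  -- the principal logarithm works.
  refine hK.induction₂ (fun x y => ∃ L, HolomorphicAtInfinityOn L s ∧
    ∀ z ∈ s, z - x = (z - y) * Complex.exp (L z)) ?_ ?_ ?_ hx hy
  · intro x hx
    have : ∀ᶠ y in 𝓝[K] x, dist y x < ε :=
      mem_nhdsWithin_of_mem_nhds (Metric.ball_mem_nhds x hε)
    filter_upwards [this, self_mem_nhdsWithin] with y hyx hy
    have hne : ∀ z ∈ s, z - y ≠ 0 := fun z hz =>
      norm_pos_iff.1 (hε.trans_le (hdist y hy z hz))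
    have hslit : ∀ z ∈ s, (z - x) / (z - y) ∈ Complex.slitPlane := by
      intro z hz
      have h1 : (z - x) / (z - y) = 1 + (y - x) / (z - y) := by
        have := hne z hz
        field_simp
        ring
      rw [h1]
      refine Complex.mem_slitPlane_of_norm_lt_one ?_
      rw [norm_div, div_lt_one (norm_pos_iff.2 (hne z hz)), ← dist_eq_norm]
      exact hyx.trans_le (hdist y hy z hz)
    refine ⟨fun z => Complex.log ((z - x) / (z - y)), ⟨?_, ?_⟩, ?_⟩
    · intro z hz
      refine DifferentiableWithinAt.clog ?_ (hslit z hz)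
      exact ((differentiableWithinAt_id).sub_const x).div
        ((differentiableWithinAt_id).sub_const y) (hne z hz)
    · refine ⟨fun u => Complex.log ((1 - x * u) / (1 - y * u)), ?_, ?_⟩
      · refine AnalyticAt.clog ?_ (by simp)
        refine AnalyticAt.div ?_ ?_ (by simp)
        · exact analyticAt_const.sub (analyticAt_const.mul analyticAt_id)
        · exact analyticAt_const.sub (analyticAt_const.mul analyticAt_id)
      · filter_upwards [Bornology.eventually_ne_cobounded (0 : ℂ)] with z hz
        congr 1
        have h1 : 1 - x * z⁻¹ = (z - x) * z⁻¹ := by field_simp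
        have h2 : 1 - y * z⁻¹ = (z - y) * z⁻¹ := by field_simp
        rw [h1, h2, mul_div_mul_right _ _ (inv_ne_zero hz)]
    · intro z hz
      have h0 := hne z hz
      simp only
      rw [Complex.exp_log (Complex.slitPlane_ne_zero (hslit z hz))]
      field_simp
  · rintro x y w hx hy hw ⟨L, hL, h1⟩ ⟨L', hL', h2⟩
    refine ⟨fun z => L' z + L z, hL'.add hL, fun z hz => ?_⟩
    rw [h1 z hz, h2 z hz, Complex.exp_add]
    ring
  · rintro x y hx hy ⟨L, hL, h1⟩
    refine ⟨fun z => -1 * L z, hL.const_mul _, fun z hz => ?_⟩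
    rw [h1 z hz, mul_assoc, ← Complex.exp_add]
    simp

lemma exists_log_prod_of_isPreconnected {K s : Set ℂ} (hK : IsPreconnected K) {ε : ℝ} (hε : 0 < ε)
    (hdist : ∀ x ∈ K, ∀ z ∈ s, ε ≤ ‖z - x‖) {y : ℂ} (hy : y ∈ K) (m : Multiset ℂ)
    (hm : ∀ x ∈ m, x ∈ K) :
    ∃ L, HolomorphicAtInfinityOn L s ∧
      ∀ z ∈ s, (m.map fun x => z - x).prod = (z - y) ^ m.card * Complex.exp (L z) := by
  induction m using Multiset.induction_on with
  | empty => exact ⟨fun _ => 0, .zero, by simp⟩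
  | cons x m ih =>
    obtain ⟨L, hL, h1⟩ := ih fun x hx => hm x (Multiset.mem_cons_of_mem hx)
    obtain ⟨L', hL', h2⟩ := exists_log_div_of_isPreconnected hK hε hdist
      (hm x (Multiset.mem_cons_self x m)) hy
    refine ⟨fun z => L' z + L z, hL'.add hL, fun z hz => ?_⟩
    rw [Multiset.map_cons, Multiset.prod_cons, h1 z hz, h2 z hz, Complex.exp_add,
      Multiset.card_cons]
    ring

/-- If `G⁻¹(p)` lies in a connected set at positive distance from `s`, then `G - p` has
a holomorphic root of order `deg G` on `s`, univalent near infinity. -/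
lemma exists_root_of_isPreconnected {K s : Set ℂ} (hK : IsPreconnected K) {ε : ℝ} (hε : 0 < ε)
    (hdist : ∀ x ∈ K, ∀ z ∈ s, ε ≤ ‖z - x‖) {G : ℂ[X]} (hG : 0 < G.natDegree) (p : ℂ)
    (hroots : ∀ x, G.eval x = p → x ∈ K) :
    ∃ H : ℂ → ℂ, DifferentiableOn ℂ H s ∧
      (∀ z ∈ s, G.eval z - p = G.leadingCoeff * H z ^ G.natDegree) ∧
      ∃ M : ℝ, ∀ z w, M < ‖z‖ → M < ‖w‖ → H z = H w → z = w := by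
  have hdeg : (G - C p).natDegree = G.natDegree := natDegree_sub_C
  have hdeg' : (G - C p).degree ≠ 0 := by
    intro h
    rw [natDegree_eq_of_degree_eq_some (n := 0) h] at hdeg
    omega
  have hlead : (G - C p).leadingCoeff = G.leadingCoeff := by
    rw [leadingCoeff, leadingCoeff, hdeg, coeff_sub, coeff_C, if_neg hG.ne', sub_zero]
  have hmem : ∀ x ∈ (G - C p).roots, x ∈ K := by
    intro x hx
    have := (mem_roots'.1 hx).2
    simp only [IsRoot.def, eval_sub, eval_C, sub_eq_zero] at this
    exact hroots x this
  obtain ⟨y, hy⟩ := IsAlgClosed.exists_root (G - C p) hdeg'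
  have hyK : y ∈ K := by
    simp only [IsRoot.def, eval_sub, eval_C, sub_eq_zero] at hy
    exact hroots y hy
  obtain ⟨L, ⟨hLd, l, hl, hLl⟩, hL⟩ :=
    exists_log_prod_of_isPreconnected hK hε hdist hyK _ hmem
  set D := G.natDegree with hD
  have hD0 : (D : ℂ) ≠ 0 := by exact_mod_cast hG.ne'
  refine ⟨fun z => (z - y) * Complex.exp (L z / D), ?_, ?_, ?_⟩
  · exact (differentiableOn_id.sub_const y).mul (hLd.div_const _).cexp
  · intro z hz
    have hsplit := IsAlgClosed.splits (G - C p)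
    have h1 : (G - C p).eval z = (G - C p).leadingCoeff *
        ((G - C p).roots.map fun x => z - x).prod := hsplit.eval_eq_prod_roots z
    have h2 : (G - C p).roots.card = D := by rw [← hsplit.natDegree_eq_card_roots, hdeg]
    rw [hL z hz, h2, hlead, eval_sub, eval_C] at h1
    rw [h1, mul_pow, ← Complex.exp_nat_mul, mul_div_cancel₀ _ hD0]
  -- In the coordinate u = 1/z, the function 1/H becomes `g`, which has a simple zero at 0 and so is
  -- injective near 0.
  · let e : ℂ → ℂ := fun u => ((1 - y * u) * Complex.exp (l u / D))⁻¹
    let g : ℂ → ℂ := fun u => u * e u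
    have he : AnalyticAt ℂ e 0 := by
      refine AnalyticAt.inv ?_ (by simp [Complex.exp_ne_zero])
      exact (analyticAt_const.sub (analyticAt_const.mul analyticAt_id)).mul
        (hl.div analyticAt_const hD0).cexp
    have hg : HasStrictDerivAt g (e 0) 0 := by
      have h1 := (hasStrictDerivAt_id (0 : ℂ)).mul he.hasStrictDerivAt
      simp only [id, one_mul, zero_mul, add_zero] at h1
      exact h1
    have he0 : e 0 ≠ 0 := by simp [e, Complex.exp_ne_zero]
    obtain ⟨t, ht, hinj⟩ : ∃ t ∈ 𝓝 (0 : ℂ), Set.InjOn g t := by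
      have hg' := hg.hasStrictFDerivAt_equiv he0
      exact ⟨_, (hg'.toOpenPartialHomeomorph g).open_source.mem_nhds
        hg'.mem_toOpenPartialHomeomorph_source, (hg'.toOpenPartialHomeomorph g).injOn⟩
    have hev : ∀ᶠ z in Bornology.cobounded ℂ, z ≠ 0 ∧ z⁻¹ ∈ t ∧ L z = l z⁻¹ :=
      (Bornology.eventually_ne_cobounded 0).and ((tendsto_inv₀_cobounded.eventually ht).and hLl)
    obtain ⟨M, -, hM⟩ := (Filter.HasBasis.cobounded_of_norm
      (atTop_basis (α := ℝ))).eventually_iff.1 hev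
    have hform : ∀ z : ℂ, M < ‖z‖ → g z⁻¹ = ((z - y) * Complex.exp (L z / D))⁻¹ := by
      intro z hz
      obtain ⟨hz0, -, hLz⟩ := hM (x := z) (le_of_lt hz)
      have h1 : 1 - y * z⁻¹ = (z - y) * z⁻¹ := by field_simp
      simp only [g, e]
      rw [hLz, h1, mul_inv, mul_inv, mul_inv, inv_inv]
      field_simp
    refine ⟨M, fun z w hz hw hzw => ?_⟩
    refine inv_injective (hinj (hM (x := z) (le_of_lt hz)).2.1 (hM (x := w) (le_of_lt hw)).2.1 ?_)
    simp only at hzw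
    rw [hform z hz, hform w hw, hzw]

/-! ### Escape to infinity -/

lemma norm_iterate_ge {g : ℂ → ℂ} {R : ℝ} (hg : ∀ z, R ≤ ‖z‖ → 2 * ‖z‖ ≤ ‖g z‖) {z : ℂ}
    (hz : R ≤ ‖z‖) (m : ℕ) : 2 ^ m * ‖z‖ ≤ ‖g^[m] z‖ := by
  induction m with
  | zero => simp
  | succ m ih =>
    have h1 : ‖z‖ ≤ 2 ^ m * ‖z‖ :=
      le_mul_of_one_le_left (norm_nonneg z) (one_le_pow₀ (by norm_num))
    have h2 := hg (g^[m] z) (hz.trans (h1.trans ih))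
    rw [Function.iterate_succ_apply', pow_succ]
    linarith

lemma le_norm_iterate {g : ℂ → ℂ} {R : ℝ} (hg : ∀ z, R ≤ ‖z‖ → 2 * ‖z‖ ≤ ‖g z‖) {z : ℂ}
    (hz : R ≤ ‖z‖) (m : ℕ) : R ≤ ‖g^[m] z‖ :=
  hz.trans <| (le_mul_of_one_le_left (norm_nonneg z)
    (one_le_pow₀ (by norm_num : (1 : ℝ) ≤ 2))).trans (norm_iterate_ge hg hz m)

lemma notMem_filledJulia_iff {g : ℂ → ℂ} {R : ℝ} (hR : 0 < R)
    (hg : ∀ z, R ≤ ‖z‖ → 2 * ‖z‖ ≤ ‖g z‖) {z : ℂ} :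
    z ∉ filledJulia g ↔ ∃ m : ℕ, R ≤ ‖g^[m] z‖ := by
  constructor
  · intro h
    by_contra! hcon
    refine h ((Metric.isBounded_closedBall (x := (0 : ℂ)) (r := R)).subset ?_)
    rintro _ ⟨m, rfl⟩
    simpa using (hcon m).le
  · rintro ⟨m, hm⟩ h
    have hb : Bornology.IsBounded (Set.range fun m : ℕ => g^[m] z) := h
    obtain ⟨B, hB⟩ := isBounded_iff_forall_norm_le.1 hb
    obtain ⟨q, hq⟩ := pow_unbounded_of_one_lt (B / R) (by norm_num : (1 : ℝ) < 2)
    have h1 := hB _ ⟨q + m, rfl⟩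
    simp only [Function.iterate_add_apply] at h1
    have h2 := norm_iterate_ge hg hm q
    rw [div_lt_iff₀ hR] at hq
    have h3 : (2 : ℝ) ^ q * R ≤ 2 ^ q * ‖g^[m] z‖ := by gcongr
    linarith

/-- Write G = Q · z + G(0) with Q nonconstant: where |Q| > 3 and |G(0)| ≤ |z|, the first term
outweighs the second by 2|z|. -/
lemma Polynomial.exists_escape_radius {G : ℂ[X]} (hG : 2 ≤ G.natDegree) :
    ∃ R : ℝ, 0 < R ∧ ∀ z, R ≤ ‖z‖ → 2 * ‖z‖ ≤ ‖G.eval z‖ := by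
  have hdeg : 0 < G.divX.degree := by
    rw [← natDegree_pos_iff_degree_pos, natDegree_divX_eq_natDegree_tsub_one]
    omega
  obtain ⟨M, hM⟩ := G.divX.exists_norm_le_of_norm_eval_le hdeg 3
  refine ⟨max (M + 1) (max 1 ‖G.coeff 0‖), by positivity, fun z hz => ?_⟩
  have h1 : M + 1 ≤ ‖z‖ := (le_max_left _ _).trans hz
  have h2 : ‖G.coeff 0‖ ≤ ‖z‖ := (le_max_right _ _).trans ((le_max_right _ _).trans hz)
  have h3 : 3 < ‖G.divX.eval z‖ := by
    by_contra hcon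
    linarith [hM z (not_lt.1 hcon)]
  have h4 : G.eval z = G.divX.eval z * z + G.coeff 0 := by
    conv_lhs => rw [← divX_mul_X_add G]
    simp
  have h5 := norm_sub_le (G.eval z) (G.coeff 0)
  rw [h4, add_sub_cancel_right, norm_mul, ← h4] at h5
  nlinarith [norm_nonneg z]

/-! ### Escaping critical values and disconnectedness -/

/-- If a critical value of a polynomial escapes, its filled Julia set is not connected. -/
theorem not_isConnected_filledJulia {G : ℂ[X]} (hG : 2 ≤ G.natDegree) {ζ : ℂ}
    (hζ : G.derivative.IsRoot ζ) (hv : G.eval ζ ∉ filledJulia fun z => G.eval z) :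
    ¬ IsConnected (filledJulia fun z => G.eval z) := by
  rintro ⟨⟨p, hp⟩, hconn⟩
  obtain ⟨R, hR, hesc⟩ := G.exists_escape_radius hG
  set g : ℂ → ℂ := fun z => G.eval z with hg
  have hiff : ∀ z, z ∉ filledJulia g ↔ ∃ m : ℕ, R ≤ ‖g^[m] z‖ := fun z =>
    notMem_filledJulia_iff hR hesc
  obtain ⟨m, hm⟩ := (hiff _).1 hv
  -- One iterate passes from ζ to its critical value, m more reach norm R, and the last makes the
  -- inequality strict.
  set P : ℂ[X] := G.comp^[m + 2] X with hPdef
  have hPeval : ∀ z, P.eval z = g^[m + 2] z := fun z => by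
    rw [hPdef, iterate_comp_eval, eval_X]
  have hPdeg : 0 < P.degree := by
    rw [← natDegree_pos_iff_degree_pos, hPdef, natDegree_iterate_comp, natDegree_X, mul_one]
    positivity
  have hPζ : R < ‖P.eval ζ‖ := by
    have h1 : g^[m + 2] ζ = g^[1] (g^[m] (g ζ)) := by
      rw [← Function.iterate_succ_apply, ← Function.iterate_add_apply]
      congr 1
      omega
    have h2 := norm_iterate_ge hesc hm 1
    rw [hPeval, h1]
    linarith
  have hKball : filledJulia g ⊆ {z | ‖P.eval z‖ < R} := by
    intro z hz
    by_contra hcon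
    rw [Set.mem_ofPred_eq, not_lt, hPeval] at hcon
    exact (hiff z).2 ⟨_, hcon⟩ hz
  have hK : IsCompact (filledJulia g) := by
    have hclosed : IsClosed (filledJulia g) := by
      have : filledJulia g = ⋂ j : ℕ, {z | ‖g^[j] z‖ ≤ R} := by
        ext z
        rw [Set.mem_iInter]
        constructor
        · intro hz j
          by_contra hcon
          exact (hiff z).2 ⟨j, (not_le.1 hcon).le⟩ hz
        · intro hz
          by_contra hcon
          obtain ⟨j, hj⟩ := (hiff z).1 hcon
          have h1 : ‖g^[j + 1] z‖ ≤ R := hz (j + 1)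
          have h2 := hesc _ hj
          rw [Function.iterate_succ_apply'] at h1
          change 2 * ‖g^[j] z‖ ≤ ‖g (g^[j] z)‖ at h2
          linarith
      rw [this]
      exact isClosed_iInter fun j =>
        isClosed_le (G.continuous.iterate j).norm continuous_const
    refine (isCompact_closedBall (0 : ℂ) R).of_isClosed_subset hclosed fun z hz => ?_
    rw [mem_closedBall_zero_iff]
    by_contra hcon
    exact (hiff z).2 ⟨0, (not_le.1 hcon).le⟩ hz
  obtain ⟨ε, hε, hthick⟩ := hK.exists_thickening_subset_open
    (isOpen_lt P.continuous.norm continuous_const) hKball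
  have hdist : ∀ x ∈ filledJulia g, ∀ z ∈ {z | R < ‖P.eval z‖}, ε ≤ ‖z - x‖ := by
    intro x hx z hz
    by_contra hcon
    have : z ∈ Metric.thickening ε (filledJulia g) :=
      Metric.mem_thickening_iff.2 ⟨x, hx, by rw [dist_eq_norm]; exact not_le.1 hcon⟩
    exact lt_asymm (a := ‖P.eval z‖) (hthick this) hz
  have hpre : ∀ x, G.eval x = p → x ∈ filledJulia g := by
    intro x hx
    by_contra hcon
    obtain ⟨j, hj⟩ := (hiff x).1 hcon
    refine (hiff p).2 ⟨j, ?_⟩ hp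
    have h1 := le_norm_iterate hesc hj 1
    change R ≤ ‖g^[1] (g^[j] x)‖ at h1
    rw [← Function.iterate_add_apply, Nat.add_comm, Function.iterate_succ_apply] at h1
    change R ≤ ‖g^[j] (G.eval x)‖ at h1
    rwa [hx] at h1
  obtain ⟨H, hH, hroot, M₁, hinj⟩ :=
    exists_root_of_isPreconnected hconn hε hdist (G := G) (by omega) p hpre
  have hs : IsOpen {z : ℂ | R < ‖P.eval z‖} := isOpen_lt continuous_const P.continuous.norm
  have hHG : ∀ z w, R < ‖P.eval z‖ → R < ‖P.eval w‖ → H z = H w → G.eval z = G.eval w := by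
    intro z w hz hw h
    have h1 := hroot z hz
    rw [h, ← hroot w hw] at h1
    exact sub_left_injective h1
  have hderiv : ∀ w, R < ‖P.eval w‖ → G.derivative.eval w =
      G.leadingCoeff * (G.natDegree * H w ^ (G.natDegree - 1) * deriv H w) := by
    intro w hw
    have hd : HasDerivAt H (deriv H w) w := (hH.differentiableAt (hs.mem_nhds hw)).hasDerivAt
    have h1 : HasDerivAt (fun z => G.eval z - p) (G.derivative.eval w) w :=
      (G.hasDerivAt w).sub_const p
    have h2 := (hd.pow G.natDegree).const_mul G.leadingCoeff
    refine h1.unique (h2.congr_of_eventuallyEq ?_)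
    filter_upwards [hs.mem_nhds hw] with z hz
    exact hroot z hz
  have hdeg' : 0 < G.derivative.degree := by
    rw [← natDegree_pos_iff_degree_pos, natDegree_derivative]
    omega
  -- For w large, H z = H w gives G z = G w, so z is large too and z = w; then H' = 0 would force G'
  -- = 0, impossible far out.
  have hlarge : ∃ M : ℝ, ∀ w, R < ‖P.eval w‖ → M < ‖w‖ → ∀ z, R < ‖P.eval z‖ →
      dslope H w z ≠ 0 := by
    obtain ⟨M₂, hM₂⟩ := G.derivative.exists_norm_le_of_norm_eval_le hdeg' 0
    obtain ⟨B, hB⟩ := (isCompact_closedBall (0 : ℂ) M₁).exists_bound_of_continuousOn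
      G.continuous.continuousOn
    obtain ⟨M₃, hM₃⟩ := G.exists_norm_le_of_norm_eval_le
      (natDegree_pos_iff_degree_pos.1 (by omega)) B
    refine ⟨max M₁ (max M₂ M₃), fun w hw hwM z hz h0 => ?_⟩
    simp only [max_lt_iff] at hwM
    have hzw : H z = H w := by
      have := sub_smul_dslope H w z
      rw [h0, smul_zero] at this
      exact sub_eq_zero.1 this.symm
    have hzM : M₁ < ‖z‖ := by
      by_contra hcon
      have h1 := hB z (by simpa using hcon)
      rw [hHG z w hz hw hzw] at h1
      linarith [hM₃ w h1]
    obtain rfl := hinj z w hzM hwM.1 hzw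
    rw [dslope_same] at h0
    have h1 := hderiv z hz
    rw [h0, mul_zero, mul_zero] at h1
    linarith [hM₂ z (by rw [h1, norm_zero])]
  have hfinal := dslope_ne_zero_of_large hPdeg hH (fun z w hz hw h => by
    rw [hPeval, hPeval]
    exact congrArg g^[m + 1] (hHG z w hz hw h)) hlarge hPζ hPζ
  rw [dslope_same] at hfinal
  have h1 := hderiv ζ hPζ
  rw [IsRoot.def.1 hζ] at h1
  have hlead : G.leadingCoeff ≠ 0 := leadingCoeff_ne_zero.2 (ne_zero_of_natDegree_gt hG)
  have hD : (G.natDegree : ℂ) ≠ 0 := Nat.cast_ne_zero.2 (by omega)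
  have hHζ : H ζ ≠ 0 := by
    intro h
    have h2 := hroot ζ hPζ
    rw [h, zero_pow (by omega), mul_zero, sub_eq_zero] at h2
    rw [h2] at hv
    exact hv hp
  exact mul_ne_zero hlead (mul_ne_zero (mul_ne_zero hD (pow_ne_zero _ hHζ)) hfinal) h1.symm

/-! ### The family a fⁿ + b -/

/-- The polynomial `a fⁿ + b`. -/
noncomputable def affineIteratePoly (f : ℂ[X]) (a b : ℂ) (n : ℕ) : ℂ[X] :=
  C a * f.comp^[n] X + C b

lemma eval_affineIteratePoly (f : ℂ[X]) (a b : ℂ) (n : ℕ) :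
    (fun z => (affineIteratePoly f a b n).eval z) = affineIterate f a b n := by
  funext z
  simp [affineIteratePoly, affineIterate, iterate_comp_eval]

lemma natDegree_affineIteratePoly (f : ℂ[X]) {a : ℂ} (ha : a ≠ 0) (b : ℂ) (n : ℕ) :
    (affineIteratePoly f a b n).natDegree = f.natDegree ^ n := by
  rw [affineIteratePoly, natDegree_add_C, natDegree_C_mul ha, natDegree_iterate_comp,
    natDegree_X, mul_one]

/-- `a f^k(c) + b` is a critical value of `a fⁿ + b` when `1 ≤ k ≤ n`. -/
lemma exists_critical_point_affineIteratePoly {f : ℂ[X]} (hf : 0 < f.natDegree) (a b : ℂ) {c : ℂ}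
    (hc : f.derivative.IsRoot c) {k n : ℕ} (hk : 1 ≤ k) (hkn : k ≤ n) :
    ∃ ζ, (affineIteratePoly f a b n).derivative.IsRoot ζ ∧
      (affineIteratePoly f a b n).eval ζ = affineIterate f a b k c := by
  have hsurj : Function.Surjective fun z => f.eval z :=
    IsAlgClosed.eval_surjective hf.ne'
  obtain ⟨ζ, hζ⟩ := (hsurj.iterate (n - k)) c
  refine ⟨ζ, ?_, ?_⟩
  · have h1 : HasDerivAt (fun z => f.eval z)^[n - k]
        (((f.comp^[n - k] X).derivative).eval ζ) ζ := by
      have := (f.comp^[n - k] X).hasDerivAt ζ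
      simpa only [iterate_comp_eval, eval_X] using this
    -- As k ≥ 1, the orbit of ζ passes through c with at least one application of f left, so f'(c) =
    -- 0 is a factor in the chain rule.
    have h2 : HasDerivAt (fun z => f.eval z) 0 ((fun z => f.eval z)^[n - k] ζ) := by
      have := f.hasDerivAt c
      rw [IsRoot.def.1 hc] at this
      rwa [hζ]
    have h3 := h2.comp ζ h1
    have h4 := (f.comp^[k - 1] X).hasDerivAt (f.eval ((fun z => f.eval z)^[n - k] ζ))
    have h5 := (h4.comp ζ h3).const_mul a |>.add_const b
    have h6 := (affineIteratePoly f a b n).hasDerivAt ζ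
    rw [eval_affineIteratePoly] at h6
    have heq : affineIterate f a b n = fun z =>
        a * ((fun w => (f.comp^[k - 1] X).eval w) ∘ (fun w => f.eval w) ∘
          (fun w => f.eval w)^[n - k]) z + b := by
      funext z
      simp only [affineIterate, Function.comp, iterate_comp_eval, eval_X]
      rw [← Function.iterate_succ_apply' (fun w => f.eval w),
        ← Function.iterate_add_apply, show k - 1 + (n - k).succ = n by omega]
    rw [heq] at h6
    have h7 := h6.unique h5
    rw [IsRoot.def, h7]
    simp
  · have := congrFun (eval_affineIteratePoly f a b n) ζ
    rw [this, affineIterate, affineIterate, ← hζ, ← Function.iterate_add_apply,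
      show k + (n - k) = n by omega]

/-- Escape of `a f^k(c) + b` under `f` implies its escape under `aₙ fⁿ + bₙ` for all large `n`,
whenever `(aₙ, bₙ) → (a, b)`. -/
lemma eventually_notMem_filledJulia {f : ℂ[X]} (hdeg : 2 ≤ f.natDegree) {a b : ℂ} (ha : a ≠ 0)
    {c : ℂ} {k : ℕ} (hk : affineIterate f a b k c ∉ filledJulia (fun z => f.eval z))
    {u : ℕ → ℂ × ℂ} (hu : Tendsto u atTop (𝓝 (a, b))) :
    ∀ᶠ n in atTop, affineIterate f (u n).1 (u n).2 k c ∉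
      filledJulia (affineIterate f (u n).1 (u n).2 n) := by
  obtain ⟨R, hR, hesc⟩ := f.exists_escape_radius hdeg
  set g : ℂ → ℂ := fun z => f.eval z with hg
  obtain ⟨j, hj⟩ := (notMem_filledJulia_iff hR hesc).1 hk
  have hj' : R < ‖g^[j + 1] (affineIterate f a b k c)‖ := by
    have := hesc _ hj
    change 2 * ‖g^[j] (affineIterate f a b k c)‖ ≤ ‖g (g^[j] (affineIterate f a b k c))‖ at this
    rw [Function.iterate_succ_apply']
    linarith
  have hu1 : Tendsto (fun n => (u n).1) atTop (𝓝 a) := (continuous_fst.tendsto _).comp hu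
  have hu2 : Tendsto (fun n => (u n).2) atTop (𝓝 b) := (continuous_snd.tendsto _).comp hu
  have hw : Tendsto (fun n => ‖g^[j + 1] (affineIterate f (u n).1 (u n).2 k c)‖) atTop
      (𝓝 ‖g^[j + 1] (affineIterate f a b k c)‖) := by
    refine (((f.continuous.iterate (j + 1)).tendsto _).comp ?_).norm
    exact (hu1.mul_const _).add hu2
  set α := ‖a‖ / 2 with hα
  set β := ‖b‖ + 1 with hβ
  have hapos : 0 < ‖a‖ := norm_pos_iff.2 ha
  have hαpos : 0 < α := by positivity
  -- With α · 2^q > 2 + β / R, the surplus β / R absorbs the translation on |x| ≥ R and leaves a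
  -- factor 2.
  obtain ⟨q, hq⟩ := pow_unbounded_of_one_lt ((2 + β / R) / α) (by norm_num : (1 : ℝ) < 2)
  rw [div_lt_iff₀ hαpos] at hq
  filter_upwards [hw.eventually (lt_mem_nhds hj'),
    hu1.norm.eventually (lt_mem_nhds (half_lt_self hapos)),
    hu2.norm.eventually (gt_mem_nhds (lt_add_one ‖b‖)),
    eventually_ge_atTop (q + (j + 1))] with n hn hn1 hn2 hnq
  have hstep : ∀ x : ℂ, R ≤ ‖x‖ → ∀ i, q ≤ i → 2 * ‖x‖ ≤ ‖(u n).1 * g^[i] x + (u n).2‖ := by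
    intro x hx i hi
    have h1 := norm_iterate_ge hesc hx i
    have h2 : (2 : ℝ) ^ q ≤ 2 ^ i := pow_le_pow_right₀ (by norm_num) hi
    have h3 := norm_sub_le ((u n).1 * g^[i] x + (u n).2) (u n).2
    rw [add_sub_cancel_right, norm_mul] at h3
    have h4 : α * (2 ^ q * ‖x‖) ≤ ‖(u n).1‖ * ‖g^[i] x‖ := by
      refine mul_le_mul hn1.le (le_trans ?_ h1) (by positivity) (norm_nonneg _)
      gcongr
    have h5 : (2 + β / R) * ‖x‖ ≤ 2 ^ q * α * ‖x‖ := by gcongr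
    have h6 : β ≤ β / R * ‖x‖ := by
      rw [div_mul_eq_mul_div, le_div_iff₀ hR]
      gcongr
    linarith
  refine (notMem_filledJulia_iff (g := affineIterate f (u n).1 (u n).2 n) hR
    (fun z hz => hstep z hz n (by omega))).2 ⟨1, ?_⟩
  -- The first j + 1 of the n iterates carry the point beyond R; the other n - (j + 1) ≥ q suffice
  -- for `hstep`, so one application of the map already escapes.
  have h1 := hstep _ hn.le (n - (j + 1)) (by omega)
  rw [← Function.iterate_add_apply, Nat.sub_add_cancel (by omega)] at h1
  change R ≤ ‖(u n).1 * g^[n] (affineIterate f (u n).1 (u n).2 k c) + (u n).2‖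
  linarith

theorem mainTheorem12 (f : ℂ[X]) (hdeg : 2 ≤ f.natDegree) (hmonic : f.Monic)
    (hcent : IsCentered f) (a b : ℂ) (ha : a ≠ 0)
    (c : ℂ) (hc : f.derivative.IsRoot c) (k : ℕ)
    (hk : affineIterate f a b k c ∉ filledJulia (fun z => f.eval z)) :
    (∃ N : ℕ, ∀ n : ℕ, N ≤ n →
      affineIterate f a b k c ∉ filledJulia (affineIterate f a b n)) ∧
    (1 ≤ k → (a, b) ∉ setLiminf (connectednessLocus f)) := by
  refine ⟨eventually_atTop.1 ?_, ?_⟩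
  · exact eventually_notMem_filledJulia hdeg ha hk (u := fun _ => (a, b)) tendsto_const_nhds
  rintro hk1 ⟨u, hmem, hu⟩
  obtain ⟨n, ⟨hn0, hconn⟩, hesc, hkn⟩ :=
    (hmem.and ((eventually_notMem_filledJulia hdeg ha hk hu).and (eventually_ge_atTop k))).exists
  obtain ⟨ζ, hζ, hval⟩ := exists_critical_point_affineIteratePoly (f := f) (by omega)
    (u n).1 (u n).2 hc hk1 hkn
  rw [← eval_affineIteratePoly] at hconn hesc
  rw [← hval] at hesc
  refine not_isConnected_filledJulia ?_ hζ hesc hconn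
  rw [natDegree_affineIteratePoly f hn0]
  exact hdeg.trans (Nat.le_self_pow (by omega) _)
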